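/- Let $n\ge 1$ be an integer and $q=2^{2n+1}$. The Suzuki group $\mathrm{Sz}(q)$, viewed as a subgroup of the symplectic group $\mathrm{Sp}_4(q)$ in the usual way (it is determined up to conjugacy in $\mathrm{Sp}_4(q)$), is not a strong Gelfand subgroup of $\mathrm{Sp}_4(q)$; that is, there is an irreducible complex character $\psi$ of $\mathrm{Sz}(q)$ and an irreducible complex character $\chi$ of $\mathrm{Sp}_4(q)$ such that $\langle \psi\uparrow \mathrm{Sp}_4(q),\,\chi\rangle\ge 2$. Here, with $\theta(x)=x^{2^{n+1}}$ on $\mathbb F_q$ (so $\theta(\theta(x))=x^2$) and $\mathrm{Sp}_4(q)$ the isometry group of the symplectic form with antidiagonal Gram matrix (all antidiagonal entries $1$), $\mathrm{Sz}(q)$ is the subgroup generated by the matrices $$\begin{pmatrix}1&0&0&0\\ a&1&0&0\\ b&\theta(a)&1&0\\ a^2\theta(a)+ab+\theta(b)&a\theta(a)+b&a&1\end{pmatrix}\quad(a,b\in\mathbb F_q),$$ the diagonal matrices $\mathrm{diag}(\lambda^{1+2^n},\lambda^{2^n},\lambda^{-2^n},\lambda^{-1-2^n})$ with $\lambda\in\mathbb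 F_q^\times$, and the antidiagonal permutation matrix. For a finite group $G$, a subgroup $H\le G$ is a strong Gelfand subgroup if for every irreducible complex character $\psi$ of $H$ the induced character $\psi\uparrow G$ is multiplicity free, i.e. $\langle\psi\uparrow G,\chi\rangle\le 1$ for every irreducible complex character $\chi$ of $G$. -/

import Mathlib

noncomputable section

/-- `χ : G → ℂ` is a (complex) irreducible character of `G`: the character of an irreducible
finite-dimensional complex representation. -/
def IsIrredCharacter {G : Type*} [Group G] (χ : G → ℂ) : Prop :=
  ∃ (V : Type) (_ : AddCommGroup V) (_ : Module ℂ V) (_ : FiniteDimensional ℂ V)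
    (ρ : Representation ℂ G V), ρ.IsIrreducible ∧ ρ.character = χ

/-- The scalar product `⟨φ, χ⟩ = |G|⁻¹ ∑ g, φ(g) χ(g⁻¹)` of two characters of a finite group
(recall that `χ(g⁻¹)` is the complex conjugate of `χ(g)` for a character `χ`). -/
def characterInner {G : Type*} [Group G] [Finite G] (φ χ : G → ℂ) : ℂ :=
  (Nat.card G : ℂ)⁻¹ * ∑ᶠ g : G, φ g * χ g⁻¹

open Classical in
/-- The character `ψ ↑ G` of `G` induced from the character `ψ` of a subgroup `H`:
`(ψ ↑ G)(g) = |H|⁻¹ ∑ x, ψ°(x⁻¹ g x)`, where `ψ°` is `ψ` extended by `0` outside `H`. -/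
def inducedCharacter {G : Type*} [Group G] [Finite G] (H : Subgroup G) (ψ : H → ℂ) : G → ℂ :=
  fun g => (Nat.card H : ℂ)⁻¹ *
    ∑ᶠ x : G, if hx : x⁻¹ * g * x ∈ H then ψ ⟨x⁻¹ * g * x, hx⟩ else 0

/-- A character `θ` of a finite group is multiplicity free if `⟨θ, χ⟩ ≤ 1` for every
irreducible character `χ`. (The scalar product of two characters is a natural number.) -/
def IsMultiplicityFree {G : Type*} [Group G] [Finite G] (θ : G → ℂ) : Prop :=
  ∀ χ : G → ℂ, IsIrredCharacter χ → (characterInner θ χ).re ≤ 1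

/-- `H` is a strong Gelfand subgroup of the finite group `G`, i.e. `(G, H)` is a strong Gelfand
pair: every irreducible character of `H` induces to a multiplicity-free character of `G`. -/
def IsStrongGelfandSubgroup {G : Type*} [Group G] [Finite G] (H : Subgroup G) : Prop :=
  ∀ ψ : H → ℂ, IsIrredCharacter ψ → IsMultiplicityFree (inducedCharacter H ψ)

/-- The symplectic group `Sp₄(F)`: the `4 × 4` matrices `A` with `A J Aᵀ = J`, where
`J = fromBlocks 0 (-1) 1 0`. -/
abbrev Sp4 (F : Type*) [Field F] : Type _ := ↥(Matrix.symplecticGroup (Fin 2) F)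

section Suzuki

variable {F : Type*} [Field F] [CharP F 2]

/-!
The three kinds of generators of the Suzuki group over the field with `2 ^ (2 * n + 1)` elements,
with `θ(x) = x ^ (2 ^ (n + 1))`, so that `θ(θ(x)) = x ^ 2`. In a basis `e₁, e₂, e₃, e₄` for which
the symplectic form has the antidiagonal Gram matrix they are Suzuki's matrices

  `( 1                    0            0  0 )`
  `( a                    1            0  0 )`
  `( b                    θ(a)         1  0 )`
  `( a²θ(a) + ab + θ(b)   aθ(a) + b    a  1 )`,

the diagonal matrices `diag(l^(1+2^n), l^(2^n), l^(-2^n), l^(-1-2^n))` and the antidiagonal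
permutation matrix. Below they are written in the order `e₁, e₂, e₄, e₃` of the basis, in which the
Gram matrix is Mathlib's `J`.
-/

/-- The lower unitriangular generators `S(a, b)`. -/
def suzukiS (n : ℕ) (a b : F) : Sp4 F :=
  ⟨Matrix.fromBlocks
      !![1, 0;
         a, 1]
      0
      !![a ^ 2 * a ^ 2 ^ (n + 1) + a * b + b ^ 2 ^ (n + 1), a * a ^ 2 ^ (n + 1) + b;
         b,                                                 a ^ 2 ^ (n + 1)]
      !![1, a;
         0, 1], by
    have h2 : (2 : F) = 0 := CharTwo.two_eq_zero
    rw [SymplecticGroup.mem_iff, Matrix.J, Matrix.fromBlocks_transpose,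
      Matrix.fromBlocks_multiply, Matrix.fromBlocks_multiply, Matrix.fromBlocks_inj]
    refine ⟨?_, ?_, ?_, ?_⟩ <;> ext i j <;> fin_cases i <;> fin_cases j <;>
      simp [Matrix.vecMul, dotProduct, Fin.sum_univ_two] <;> grind⟩

/-- The diagonal generators `M(l)`, for `l ∈ Fˣ`. -/
def suzukiM (n : ℕ) (l : Fˣ) : Sp4 F :=
  ⟨Matrix.fromBlocks
      !![(l : F) ^ (1 + 2 ^ n), 0;
         0,                     (l : F) ^ 2 ^ n]
      0
      0
      !![((l : F)⁻¹) ^ (1 + 2 ^ n), 0;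
         0,                         ((l : F)⁻¹) ^ 2 ^ n], by
    rw [SymplecticGroup.mem_iff, Matrix.J, Matrix.fromBlocks_transpose,
      Matrix.fromBlocks_multiply, Matrix.fromBlocks_multiply, Matrix.fromBlocks_inj]
    refine ⟨?_, ?_, ?_, ?_⟩ <;> ext i j <;> fin_cases i <;> fin_cases j <;>
      simp [Matrix.vecMul, dotProduct, Fin.sum_univ_two]⟩

variable (F) in
/-- The generator `T`, which exchanges `e₁` with `e₄` and `e₂` with `e₃`. -/
def suzukiT : Sp4 F :=
  ⟨Matrix.fromBlocks 0 1 1 0, by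
    rw [SymplecticGroup.mem_iff, Matrix.J, Matrix.fromBlocks_transpose,
      Matrix.fromBlocks_multiply, Matrix.fromBlocks_multiply, Matrix.fromBlocks_inj]
    simp [CharTwo.neg_eq]⟩

variable (F) in
/-- The Suzuki group `Sz(q) ≤ Sp₄(q)`, where `F` is the field with `q = 2 ^ (2 * n + 1)` elements:
the subgroup generated by all `S(a, b)`, all `M(l)` and `T`. -/
def suzukiGroup (n : ℕ) : Subgroup (Sp4 F) :=
  Subgroup.closure ({g | ∃ a b : F, g = suzukiS n a b} ∪ {g | ∃ l : Fˣ, g = suzukiM n l} ∪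
    {suzukiT F})

end Suzuki

end

/-! A counting argument replaces character tables. Let `X` be a `G`-set and `Y` an `H`-set. By
Burnside, the scalar product of two permutation characters counts orbits on the product, so a
permutation character has at most as many irreducible constituents, counted with multiplicity, as
its rank. If `H` is a strong Gelfand subgroup, Frobenius reciprocity lets each pair of constituents
(one from `Y`, one from `X`) contribute at most 1 to the number of `H`-orbits on `Y × X`. That
number is at least `|X||Y|/|H|`, which gives `IsStrongGelfandSubgroup.card_mul_card_le`.

For `Y` take the cosets of a Borel subgroup of `Sz(q)`, of order at most `q²(q-1)`; the Bruhat
decomposition (`exists_suzuki_borel`) bounds the rank by 2. For `X` take the pairs of a nonzero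
vector and a totally isotropic plane containing it: there are at least `(q²-1)q³` of them
(`le_card_flags`), and the rank is at most `4q` (`card_orbits_flags_le`). The inequality then reads
`(q²-1)q³ ≤ q²(q-1)·2·4q`, that is `q + 1 ≤ 8`, which fails for `q ≥ 8`. -/

noncomputable section

open Representation

/-! ### Irreducible constituents, scalar products and Frobenius reciprocity. -/

/-- The character of an irreducible representation on a space in any universe is an irreducible
character. -/
theorem isIrredCharacter_character {G V : Type*} [Group G] [AddCommGroup V] [Module ℂ V]
    [FiniteDimensional ℂ V] (ρ : Representation ℂ G V) (h : ρ.IsIrreducible) :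
    IsIrredCharacter ρ.character := by
  -- `IsIrredCharacter` asks for a space in `Type`, so the representation is transported to
  -- coordinate space.
  let e : V ≃ₗ[ℂ] (Fin (Module.finrank ℂ V) → ℂ) := (Module.finBasis ℂ V).equivFun
  let σ : Representation ℂ G (Fin (Module.finrank ℂ V) → ℂ) :=
    { toFun := fun g => e.conj (ρ g)
      map_one' := by ext; simp
      map_mul' := fun x y => by ext; simp [LinearEquiv.conj_apply] }
  let φ : Representation.Equiv ρ σ :=
    Representation.Equiv.mk e (fun g => by ext; simp [σ, LinearEquiv.conj_apply])
  refine ⟨_, _, _, inferInstance, σ, ?_, (char_iso φ).symm⟩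
  let E : Subrepresentation ρ ≃o Subrepresentation σ :=
    { toFun := fun U => ⟨U.toSubmodule.map e.toLinearMap, fun g v hv => by
        obtain ⟨u, hu, rfl⟩ := hv
        exact ⟨ρ g u, U.apply_mem_toSubmodule g hu, by simp [σ, LinearEquiv.conj_apply]⟩⟩
      invFun := fun U => ⟨U.toSubmodule.comap e.toLinearMap, fun g v hv => by
        have := U.apply_mem_toSubmodule g hv
        simpa [σ, LinearEquiv.conj_apply] using this⟩
      left_inv := fun U => by
        apply Subrepresentation.toSubmodule_injective
        exact Submodule.comap_map_eq_of_injective e.injective _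
      right_inv := fun U => by
        apply Subrepresentation.toSubmodule_injective
        exact Submodule.map_comap_eq_of_surjective e.surjective _
      map_rel_iff' := fun {U U'} =>
        Submodule.map_le_map_iff_of_injective e.injective U.toSubmodule U'.toSubmodule }
  exact (OrderIso.isSimpleOrder_iff E).mp h

/-- A character is the sum of the characters of a subrepresentation and of a complement. -/
theorem character_eq_add_of_isCompl {G V : Type*} [Group G] [AddCommGroup V] [Module ℂ V]
    [FiniteDimensional ℂ V] (ρ : Representation ℂ G V) {U W : Subrepresentation ρ}
    (h : IsCompl U.toSubmodule W.toSubmodule) :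
    ρ.character = U.toRepresentation.character + W.toRepresentation.character := by
  ext g
  let e := Submodule.prodEquivOfIsCompl _ _ h
  have : ρ g = e.conj ((U.toRepresentation g).prodMap (W.toRepresentation g)) := by
    ext v
    obtain ⟨⟨u, w⟩, rfl⟩ := e.surjective v
    simp [LinearEquiv.conj_apply, e, Subrepresentation.toRepresentation]
  simp only [character, Pi.add_apply]
  rw [this, LinearMap.trace_conj', LinearMap.trace_prodMap']

/-- Complete reducibility on the level of characters. -/
theorem exists_character_eq_sum_irred {G : Type*} [Group G] [Finite G] (d : ℕ) :
    ∀ {V : Type*} [AddCommGroup V] [Module ℂ V] [FiniteDimensional ℂ V]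
      (ρ : Representation ℂ G V), Module.finrank ℂ V ≤ d →
      ∃ (ι : Type) (_ : Fintype ι) (χ : ι → G → ℂ),
        (∀ i, IsIrredCharacter (χ i)) ∧ ρ.character = ∑ i, χ i := by
  -- The invertibility that Maschke's theorem needs; it feeds the instance `hss` below.
  have hcard : NeZero (Nat.card G : ℂ) := ⟨Nat.cast_ne_zero.mpr Nat.card_pos.ne'⟩
  induction d with
  | zero =>
    intro V _ _ _ ρ hd
    have := Module.finrank_zero_iff.mp (Nat.le_zero.mp hd)
    refine ⟨Empty, inferInstance, fun i => i.elim, fun i => i.elim, ?_⟩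
    ext g
    have : ρ g = 0 := by ext v; exact Subsingleton.elim _ _
    simp [character, this]
  | succ d ih =>
    intro V _ _ _ ρ hd
    by_cases hV : Subsingleton V
    · exact ih ρ (by rw [Module.finrank_zero_of_subsingleton]; exact Nat.zero_le _)
    rw [not_subsingleton_iff_nontrivial] at hV
    by_cases hirr : ρ.IsIrreducible
    · exact ⟨Unit, inferInstance, fun _ => ρ.character,
        fun _ => isIrredCharacter_character ρ hirr, by simp⟩
    obtain ⟨U, hU0, hU1⟩ : ∃ U : Subrepresentation ρ, U ≠ ⊥ ∧ U ≠ ⊤ := by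
      by_contra! hc
      have hnt : Nontrivial (Subrepresentation ρ) := by
        refine ⟨⊥, ⊤, fun h => ?_⟩
        have h' : (⊥ : Submodule ℂ V) = ⊤ := congrArg Subrepresentation.toSubmodule h
        exact bot_ne_top h'
      exact hirr ⟨fun U => or_iff_not_imp_left.mpr (hc U)⟩
    have hss : IsSemisimpleRepresentation ρ := inferInstance
    obtain ⟨W, hW⟩ := exists_isCompl U
    have hUW : IsCompl U.toSubmodule W.toSubmodule := by
      refine IsCompl.of_eq ?_ ?_
      · exact congrArg Subrepresentation.toSubmodule hW.inf_eq_bot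
      · exact congrArg Subrepresentation.toSubmodule hW.sup_eq_top
    have hsum := Submodule.finrank_add_eq_of_isCompl hUW
    have hUd : Module.finrank ℂ U.toSubmodule < Module.finrank ℂ V :=
      Submodule.finrank_lt (fun h =>
        hU1 (Subrepresentation.toSubmodule_injective h))
    have hUp : Module.finrank ℂ U.toSubmodule ≠ 0 := fun h =>
      hU0 (Subrepresentation.toSubmodule_injective (Submodule.finrank_eq_zero.mp h))
    obtain ⟨ι, _, χ, hχ, e⟩ := ih U.toRepresentation (by omega)
    obtain ⟨κ, _, ψ, hψ, e'⟩ := ih W.toRepresentation (by omega)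
    refine ⟨ι ⊕ κ, inferInstance, Sum.elim χ ψ, ?_, ?_⟩
    · rintro (i | j)
      · exact hχ i
      · exact hψ j
    · rw [character_eq_add_of_isCompl ρ hUW, e, e', Fintype.sum_sum_type]
      simp

theorem characterInner_eq_sum {G : Type*} [Group G] [Fintype G] (φ χ : G → ℂ) :
    characterInner φ χ = (Nat.card G : ℂ)⁻¹ * ∑ g : G, φ g * χ g⁻¹ := by
  rw [characterInner, finsum_eq_sum_of_fintype]

theorem characterInner_sum_sum {G ι κ : Type*} [Group G] [Finite G] [Fintype ι] [Fintype κ]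
    (φ : ι → G → ℂ) (χ : κ → G → ℂ) :
    characterInner (∑ i, φ i) (∑ k, χ k) = ∑ i, ∑ k, characterInner (φ i) (χ k) := by
  have := Fintype.ofFinite G
  simp only [characterInner_eq_sum, ← Finset.mul_sum, Finset.sum_apply, Finset.sum_mul_sum]
  congr 1
  rw [Finset.sum_comm]
  exact Finset.sum_congr rfl fun i _ => by
    simp only [Finset.mul_sum]
    exact Finset.sum_comm

/-- Being the dimension of a space of intertwining maps, the scalar product is a natural number;
this gives nonnegativity, and by Schur the value 1 on the diagonal. -/
theorem characterInner_character {G V W : Type*} [Group G] [Finite G] [AddCommGroup V] [Module ℂ V]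
    [FiniteDimensional ℂ V] [AddCommGroup W] [Module ℂ W] [FiniteDimensional ℂ W]
    (ρ : Representation ℂ G V) (σ : Representation ℂ G W) :
    characterInner σ.character ρ.character = Module.finrank ℂ (IntertwiningMap ρ σ) := by
  have := Fintype.ofFinite G
  have : Invertible (Nat.card G : ℂ) :=
    invertibleOfNonzero (Nat.cast_ne_zero.mpr Nat.card_pos.ne')
  rw [characterInner_eq_sum, card_inv_mul_sum_char_mul_char_eq_finrank]

theorem characterInner_irred_nonneg {G : Type*} [Group G] [Finite G] {φ χ : G → ℂ}
    (hφ : IsIrredCharacter φ) (hχ : IsIrredCharacter χ) : 0 ≤ (characterInner φ χ).re := by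
  obtain ⟨V, _, _, _, ρ, -, rfl⟩ := hφ
  obtain ⟨W, _, _, _, σ, -, rfl⟩ := hχ
  rw [characterInner_character, Complex.natCast_re]
  exact Nat.cast_nonneg _

theorem characterInner_irred_self {G : Type*} [Group G] [Finite G] {χ : G → ℂ}
    (hχ : IsIrredCharacter χ) : (characterInner χ χ).re = 1 := by
  obtain ⟨W, _, _, _, σ, h, rfl⟩ := hχ
  rw [characterInner_character, IsIrreducible.finrank_intertwiningMap_self]
  simp

/-- The number of irreducible constituents of a character is at most its squared norm. -/
theorem card_le_characterInner_sum {G ι : Type*} [Group G] [Finite G] [Fintype ι]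
    {χ : ι → G → ℂ} (hχ : ∀ i, IsIrredCharacter (χ i)) :
    (Fintype.card ι : ℝ) ≤ (characterInner (∑ i, χ i) (∑ i, χ i)).re := by
  rw [characterInner_sum_sum, Complex.re_sum]
  calc (Fintype.card ι : ℝ) = ∑ i : ι, (1 : ℝ) := by simp
    _ ≤ _ := Finset.sum_le_sum fun i _ => ?_
  rw [Complex.re_sum, ← characterInner_irred_self (hχ i)]
  -- All terms are nonnegative, so the diagonal one alone bounds the inner sum from below.
  exact Finset.single_le_sum (f := fun k => (characterInner (χ i) (χ k)).re)
    (fun k _ => characterInner_irred_nonneg (hχ i) (hχ k)) (Finset.mem_univ i)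

/-- Frobenius reciprocity. -/
theorem characterInner_inducedCharacter {G : Type*} [Group G] [Finite G] (H : Subgroup G)
    (ψ : H → ℂ) (χ : G → ℂ) (hχ : ∀ g x, χ (x * g * x⁻¹) = χ g) :
    characterInner (inducedCharacter H ψ) χ = characterInner ψ (fun h => χ h) := by
  classical
  have := Fintype.ofFinite G
  have := Fintype.ofFinite H
  let ψ₀ : G → ℂ := fun x => if hx : x ∈ H then ψ ⟨x, hx⟩ else 0
  have hind : ∀ g, inducedCharacter H ψ g = (Nat.card H : ℂ)⁻¹ * ∑ x : G, ψ₀ (x⁻¹ * g * x) := by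
    intro g
    rw [inducedCharacter, finsum_eq_sum_of_fintype]
  -- Substituting along conjugation by `x` shows that the sum over `g` does not depend on `x`; the
  -- sum over `x` then only cancels `|G|`.
  have hx : ∀ x : G, ∑ g : G, ψ₀ (x⁻¹ * g * x) * χ g⁻¹ = ∑ g : G, ψ₀ g * χ g⁻¹ := by
    intro x
    refine Fintype.sum_equiv (MulAut.conj x⁻¹).toEquiv _ _ fun g => ?_
    simp only [MulEquiv.toEquiv_eq_coe, EquivLike.coe_coe, MulAut.conj_apply, inv_inv]
    rw [← hχ g⁻¹ x⁻¹]
    group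
  have hH : ∑ g : G, ψ₀ g * χ g⁻¹ = ∑ h : H, ψ h * χ (h : G)⁻¹ := by
    rw [← Finset.sum_subset (Finset.subset_univ (Finset.univ.filter (· ∈ H)))
      (fun g _ hg => by
        have : g ∉ H := by simpa using hg
        simp [ψ₀, this])]
    rw [Finset.sum_subtype (p := (· ∈ H)) _ (by simp)]
    refine Fintype.sum_equiv (Equiv.refl _) _ _ fun h => ?_
    simp [ψ₀]
  have hG : (Nat.card G : ℂ) ≠ 0 := Nat.cast_ne_zero.mpr Nat.card_pos.ne'
  rw [characterInner_eq_sum, characterInner_eq_sum]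
  simp only [hind, mul_assoc, Finset.sum_mul]
  rw [← Finset.mul_sum, Finset.sum_comm]
  simp only [mul_assoc] at hx
  simp only [hx, Finset.sum_const, Finset.card_univ, hH, Nat.card_eq_fintype_card] at hG ⊢
  rw [nsmul_eq_mul]
  simp only [Subgroup.coe_inv]
  field_simp

/-! ### Permutation characters and the orbit inequality. -/

/-- The permutation representation on the functions on a `G`-set. -/
def permRep (G X : Type*) [Group G] [MulAction G X] : Representation ℂ G (X → ℂ) where
  toFun g := LinearMap.funLeft ℂ ℂ (fun x => g⁻¹ • x)
  map_one' := by ext; simp [LinearMap.funLeft]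
  map_mul' a b := by ext; simp [LinearMap.funLeft, mul_smul]

theorem permRep_character {G X : Type*} [Group G] [MulAction G X] [Finite X] (g : G) :
    (permRep G X).character g = Nat.card (MulAction.fixedBy X g) := by
  classical
  have := Fintype.ofFinite X
  rw [character, LinearMap.trace_eq_matrix_trace ℂ (Pi.basisFun ℂ X), Matrix.trace]
  have : ∀ x : X, g⁻¹ • x = x ↔ x ∈ MulAction.fixedBy X g := fun x => by
    rw [MulAction.mem_fixedBy, inv_smul_eq_iff, eq_comm]
  simp [permRep, LinearMap.funLeft, Pi.single_apply, this,
    Finset.sum_boole, Fintype.card_subtype]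

/-- Burnside's lemma on `X × Y`: the points fixed by `g` form a product, and `g⁻¹` fixes the same
points as `g`. -/
theorem characterInner_permRep {G X Y : Type*} [Group G] [Finite G] [MulAction G X] [Finite X]
    [MulAction G Y] [Finite Y] :
    characterInner (permRep G X).character (permRep G Y).character =
      Nat.card (MulAction.orbitRel.Quotient G (X × Y)) := by
  classical
  have := Fintype.ofFinite G
  have := Fintype.ofFinite X
  have := Fintype.ofFinite Y
  have := Fintype.ofFinite (MulAction.orbitRel.Quotient G (X × Y))
  have hG : (Nat.card G : ℂ) ≠ 0 := Nat.cast_ne_zero.mpr Nat.card_pos.ne'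
  have hB := MulAction.sum_card_fixedBy_eq_card_orbits_mul_card_group G (X × Y)
  rw [characterInner_eq_sum, inv_mul_eq_iff_eq_mul₀ hG, mul_comm, Nat.card_eq_fintype_card,
    Nat.card_eq_fintype_card, ← Nat.cast_mul]
  refine Eq.trans ?_ (congrArg (Nat.cast : ℕ → ℂ) hB)
  rw [Nat.cast_sum]
  refine Finset.sum_congr rfl fun g _ => ?_
  rw [permRep_character, permRep_character, ← Nat.cast_mul, ← Nat.card_prod,
    ← Nat.card_eq_fintype_card]
  congr 1
  refine Nat.card_congr ⟨fun p => ⟨(p.1.1, p.2.1), ?_⟩, fun p => (⟨p.1.1, ?_⟩, ⟨p.1.2, ?_⟩),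
    fun p => rfl, fun p => rfl⟩
  · have h1 := p.1.2
    have h2 := p.2.2
    rw [MulAction.mem_fixedBy] at h1 h2 ⊢
    rw [inv_smul_eq_iff, eq_comm] at h2
    rw [Prod.smul_mk, h1, h2]
  · exact congrArg Prod.fst p.2
  · rw [MulAction.mem_fixedBy, inv_smul_eq_iff, eq_comm]
    exact congrArg Prod.snd p.2

/-- The number of orbits of `H` on `X × Y` is at least `|X| * |Y| / |H|`. -/
theorem card_mul_card_le_orbits {H X Y : Type*} [Group H] [Finite H] [MulAction H X] [Finite X]
    [MulAction H Y] [Finite Y] : Nat.card X * Nat.card Y ≤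
      Nat.card H * Nat.card (MulAction.orbitRel.Quotient H (X × Y)) := by
  classical
  have := Fintype.ofFinite H
  have := Fintype.ofFinite X
  have := Fintype.ofFinite Y
  have := Fintype.ofFinite (MulAction.orbitRel.Quotient H (X × Y))
  have hB := MulAction.sum_card_fixedBy_eq_card_orbits_mul_card_group H (X × Y)
  simp only [Nat.card_eq_fintype_card]
  rw [mul_comm (Fintype.card H), ← hB, ← Fintype.card_prod]
  -- In Burnside's sum only the identity term is kept.
  refine le_trans (le_of_eq ?_) (Finset.single_le_sum
    (f := fun g : H => Fintype.card (MulAction.fixedBy (X × Y) g))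
    (fun _ _ => Nat.zero_le _) (Finset.mem_univ 1))
  rw [← Nat.card_eq_fintype_card, ← Nat.card_eq_fintype_card, MulAction.fixedBy_one_eq_univ]
  simp

/-- For a strong Gelfand subgroup `H` of `G`, the number of orbits of `H` on the product of
a `G`-set and an `H`-set is bounded by the product of the ranks of the two actions. -/
theorem IsStrongGelfandSubgroup.card_mul_card_le {G X Y : Type*} [Group G] [Finite G]
    {H : Subgroup G} (hGH : IsStrongGelfandSubgroup H) [MulAction G X] [Finite X]
    [MulAction H Y] [Finite Y] :
    Nat.card X * Nat.card Y ≤ Nat.card H *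
      (Nat.card (MulAction.orbitRel.Quotient H (Y × Y)) *
        Nat.card (MulAction.orbitRel.Quotient G (X × X))) := by
  refine card_mul_card_le_orbits.trans (Nat.mul_le_mul_left _ ?_)
  rw [Nat.card_congr (Quotient.congr (rb := MulAction.orbitRel H (Y × X)) (Equiv.prodComm X Y) (by
    rintro ⟨x, y⟩ ⟨x', y'⟩
    simp only [MulAction.orbitRel_apply, MulAction.mem_orbit_iff, Equiv.prodComm_apply,
      Prod.swap_prod_mk, Prod.smul_mk, Prod.mk.injEq, and_comm]))]
  obtain ⟨ι, _, χ, hχ, e⟩ := exists_character_eq_sum_irred _ (permRep G X) le_rfl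
  obtain ⟨κ, _, ψ, hψ, e'⟩ := exists_character_eq_sum_irred _ (permRep H Y) le_rfl
  have h1 := card_le_characterInner_sum hχ
  have h2 := card_le_characterInner_sum hψ
  rw [← e, characterInner_permRep, Complex.natCast_re] at h1
  rw [← e', characterInner_permRep, Complex.natCast_re] at h2
  have h3 : (permRep H X).character = ∑ i, (fun h : H => χ i h) := by
    ext h
    have : (permRep H X).character h = (permRep G X).character h := by
      rw [permRep_character, permRep_character]
      rfl
    rw [this, e]
    simp
  have h4 : (Nat.card (MulAction.orbitRel.Quotient H (Y × X)) : ℝ) ≤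
      Fintype.card κ * Fintype.card ι := by
    rw [← Complex.natCast_re, ← characterInner_permRep (X := Y) (Y := X), h3, e',
      characterInner_sum_sum, Complex.re_sum]
    -- Each pair of constituents contributes at most 1: by Frobenius reciprocity its term is a
    -- multiplicity in an induced character.
    calc _ ≤ ∑ _j : κ, ∑ _i : ι, (1 : ℝ) := Finset.sum_le_sum fun j _ => ?_
      _ = _ := by simp
    rw [Complex.re_sum]
    refine Finset.sum_le_sum fun i _ => ?_
    have hc : ∀ g x, χ i (x * g * x⁻¹) = χ i g := by
      obtain ⟨V, _, _, _, ρ, -, hρ⟩ := hχ i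
      intro g x
      rw [← hρ, char_conj]
    rw [← characterInner_inducedCharacter H (ψ j) (χ i) hc]
    exact hGH (ψ j) (hψ j) (χ i) (hχ i)
  have h5 : (Nat.card (MulAction.orbitRel.Quotient H (Y × X)) : ℝ) ≤
      (Nat.card (MulAction.orbitRel.Quotient H (Y × Y)) : ℝ) *
        (Nat.card (MulAction.orbitRel.Quotient G (X × X)) : ℝ) :=
    h4.trans (mul_le_mul h2 h1 (Nat.cast_nonneg _) (Nat.cast_nonneg _))
  exact_mod_cast h5

end

noncomputable section

/-! ### Matrix identities behind the Bruhat decomposition. -/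

section SuzukiBruhat

variable {F : Type*} [Field F]

/-- The matrix underlying `suzukiS n a b`, where `A` and `B` are the images of `a` and `b` under
the twisting endomorphism. -/
def lowerUni (a A b B : F) : Matrix (Fin 2 ⊕ Fin 2) (Fin 2 ⊕ Fin 2) F :=
  Matrix.fromBlocks !![1, 0; a, 1] 0 !![a ^ 2 * A + a * b + B, a * A + b; b, A] !![1, a; 0, 1]

/-- The matrix underlying `suzukiM n l` with `u = l ^ 2 ^ n`. -/
def torusMat (l u : F) : Matrix (Fin 2 ⊕ Fin 2) (Fin 2 ⊕ Fin 2) F :=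
  Matrix.fromBlocks !![l * u, 0; 0, u] 0 0 !![l⁻¹ * u⁻¹, 0; 0, u⁻¹]

theorem coe_suzukiS [CharP F 2] (n : ℕ) (a b : F) :
    (suzukiS n a b : Matrix (Fin 2 ⊕ Fin 2) (Fin 2 ⊕ Fin 2) F) =
      lowerUni a (a ^ 2 ^ (n + 1)) b (b ^ 2 ^ (n + 1)) := rfl

theorem coe_suzukiM [CharP F 2] (n : ℕ) (l : Fˣ) :
    (suzukiM n l : Matrix (Fin 2 ⊕ Fin 2) (Fin 2 ⊕ Fin 2) F) =
      torusMat (l : F) ((l : F) ^ 2 ^ n) := by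
  simp [suzukiM, torusMat, pow_add]

/-- With the twisted entries `A, B, C, D` as independent variables this is a polynomial identity in
characteristic two; that the twist is compatible with it is checked only in `suzukiS_mul`. -/
theorem lowerUni_mul [CharP F 2] (a A b B c C d D : F) :
    lowerUni a A b B * lowerUni c C d D =
      lowerUni (a + c) (A + C) (b + d + A * c) (B + D + a ^ 2 * C) := by
  have h2 : (2 : F) = 0 := CharTwo.two_eq_zero
  rw [lowerUni, lowerUni, lowerUni, Matrix.fromBlocks_multiply, Matrix.fromBlocks_inj]
  refine ⟨?_, ?_, ?_, ?_⟩ <;> ext i j <;> fin_cases i <;> fin_cases j <;>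
    simp <;> grind

theorem torusMat_mul (l u l' u' : F) :
    torusMat l u * torusMat l' u' = torusMat (l * l') (u * u') := by
  rw [torusMat, torusMat, torusMat, Matrix.fromBlocks_multiply, Matrix.fromBlocks_inj]
  refine ⟨?_, ?_, ?_, ?_⟩ <;> ext i j <;> fin_cases i <;> fin_cases j <;>
    simp <;> ring

theorem torusMat_mul_lowerUni {l u : F} (hl : l ≠ 0) (hu : u ≠ 0) (a A b B : F) :
    torusMat l u * lowerUni a A b B =
      lowerUni (a / l) (A / u ^ 2) (b / (u ^ 2 * l)) (B / (l ^ 2 * u ^ 2)) * torusMat l u := by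
  rw [torusMat, lowerUni, lowerUni, Matrix.fromBlocks_multiply, Matrix.fromBlocks_multiply,
    Matrix.fromBlocks_inj]
  refine ⟨?_, ?_, ?_, ?_⟩ <;> ext i j <;> fin_cases i <;> fin_cases j <;>
    simp <;> field_simp

/-- The Bruhat decomposition of the conjugate of a lower unitriangular element by the
antidiagonal permutation matrix. -/
theorem swap_lowerUni_swap [CharP F 2] (a A b B f φ : F) (hf : f ≠ 0) (hφ : φ ≠ 0)
    (ef : f = a ^ 2 * A + a * b + B) (eφ : φ = A ^ 2 * a ^ 2 + A * B + b ^ 2) :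
    Matrix.fromBlocks 0 1 1 0 * lowerUni a A b B * Matrix.fromBlocks 0 1 1 0 =
      lowerUni (b / f) (B / φ) (a / f) (A / φ) * Matrix.fromBlocks 0 1 1 0 *
        (torusMat (φ / f ^ 2) (f / φ) *
          lowerUni ((a * A + b) / f) ((A * a ^ 2 + B) / φ)
            (a / f + (a * A + b) / f * ((A * a ^ 2 + B) / φ))
            (A / φ + (A * a ^ 2 + B) / φ * ((a * A + b) / f) ^ 2)) := by
  have h2 : (2 : F) = 0 := CharTwo.two_eq_zero
  -- Once denominators are cleared, every entry is a polynomial identity following from `ef`, `eφ`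
  -- and `2 = 0`.
  simp only [torusMat, lowerUni, Matrix.fromBlocks_multiply, Matrix.fromBlocks_inj]
  refine ⟨?_, ?_, ?_, ?_⟩ <;> ext i j <;> fin_cases i <;> fin_cases j <;>
    simp <;> field_simp <;> grind

end SuzukiBruhat

/-! ### The Borel subgroup and the Bruhat decomposition of the Suzuki group. -/

section SuzukiBorel

variable {F : Type*} [Field F]

theorem twist_twist [Finite F] {n : ℕ} (hF : Nat.card F = 2 ^ (2 * n + 1)) (x : F) :
    (x ^ 2 ^ (n + 1)) ^ 2 ^ (n + 1) = x ^ 2 := by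
  have := Fintype.ofFinite F
  have h := FiniteField.pow_card x
  rw [← Nat.card_eq_fintype_card, hF] at h
  rw [← pow_mul, ← pow_add, show n + 1 + (n + 1) = (2 * n + 1) + 1 by ring, pow_succ, pow_mul, h]

/-- The map `x ↦ x ^ 2 ^ n` inverts the twist, so a torus entry `u = l ^ 2 ^ n` can be identified by
twisting it. -/
theorem twist_half [Finite F] {n : ℕ} (hF : Nat.card F = 2 ^ (2 * n + 1)) (x : F) :
    (x ^ 2 ^ n) ^ 2 ^ (n + 1) = x := by
  have := Fintype.ofFinite F
  have h := FiniteField.pow_card x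
  rw [← Nat.card_eq_fintype_card, hF] at h
  rw [← pow_mul, ← pow_add, show n + (n + 1) = 2 * n + 1 by ring, h]

variable [CharP F 2]

theorem add_twist (n : ℕ) (x y : F) :
    (x + y) ^ 2 ^ (n + 1) = x ^ 2 ^ (n + 1) + y ^ 2 ^ (n + 1) :=
  add_pow_char_pow x y 2 (n + 1)

/-- The norm form of the Suzuki group is anisotropic. -/
theorem suzuki_form_ne_zero [Finite F] {n : ℕ} (hF : Nat.card F = 2 ^ (2 * n + 1)) {a b : F}
    (h : ¬ (a = 0 ∧ b = 0)) : a ^ 2 * a ^ 2 ^ (n + 1) + a * b + b ^ 2 ^ (n + 1) ≠ 0 := by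
  have h2 : (2 : F) = 0 := CharTwo.two_eq_zero
  have hn : 2 ^ (n + 1) ≠ 0 := by positivity
  intro hf
  by_cases ha : a = 0
  · subst ha
    simp only [ne_eq, OfNat.ofNat_ne_zero, not_false_eq_true, zero_pow, zero_mul, zero_add,
      pow_eq_zero_iff hn] at hf
    exact h ⟨rfl, hf⟩
  · set A := a ^ 2 ^ (n + 1) with hA
    have hA0 : A ≠ 0 := pow_ne_zero _ ha
    -- This scaling turns the form into `a² A (1 + t + θ(t))`. A zero forces `θ(t) = 1 + t`, hence
    -- `t² = θ(θ(t)) = t`, so `t` is 0 or 1; the twist fixes both, a contradiction.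
    obtain ⟨t, rfl⟩ : ∃ t, b = a * A * t := ⟨b / (a * A), by field_simp⟩
    rw [mul_pow, mul_pow, ← hA, hA, twist_twist hF, ← hA] at hf
    have ht : t ^ 2 ^ (n + 1) = 1 + t := by
      have : a ^ 2 * A * (1 + t + t ^ 2 ^ (n + 1)) = 0 := by rw [← hf]; ring
      have := (mul_eq_zero.mp this).resolve_left (by positivity)
      grind
    have h3 := twist_twist hF t
    rw [ht, add_twist, one_pow, ht] at h3
    have h4 : t * (t - 1) = 0 := by grind
    rcases mul_eq_zero.mp h4 with h5 | h5
    · rw [h5, zero_pow hn] at ht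
      simp at ht
    · rw [sub_eq_zero.mp h5, one_pow] at ht
      simp at ht

theorem suzukiS_mul (n : ℕ) [Finite F] (hF : Nat.card F = 2 ^ (2 * n + 1)) (a b c d : F) :
    suzukiS n a b * suzukiS n c d = suzukiS n (a + c) (b + d + a ^ 2 ^ (n + 1) * c) := by
  apply Subtype.ext
  rw [Submonoid.coe_mul, coe_suzukiS, coe_suzukiS, coe_suzukiS, lowerUni_mul, add_twist, add_twist,
    add_twist, mul_pow, twist_twist hF]

theorem suzukiS_zero (n : ℕ) : suzukiS n (0 : F) 0 = 1 := by
  apply Subtype.ext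
  rw [coe_suzukiS, Submonoid.coe_one, ← Matrix.fromBlocks_one, lowerUni, Matrix.fromBlocks_inj]
  refine ⟨?_, ?_, ?_, ?_⟩ <;> ext i j <;> fin_cases i <;> fin_cases j <;> simp

theorem suzukiS_inv (n : ℕ) [Finite F] (hF : Nat.card F = 2 ^ (2 * n + 1)) (a b : F) :
    (suzukiS n a b)⁻¹ = suzukiS n a (b + a ^ 2 ^ (n + 1) * a) := by
  rw [inv_eq_iff_mul_eq_one, suzukiS_mul n hF, ← suzukiS_zero n]
  congr 1
  · exact CharTwo.add_self_eq_zero a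
  · have h2 : (2 : F) = 0 := CharTwo.two_eq_zero
    grind

theorem suzukiM_mul (n : ℕ) (l l' : Fˣ) :
    (suzukiM n l * suzukiM n l' : Sp4 F) = suzukiM n (l * l') := by
  apply Subtype.ext
  rw [Submonoid.coe_mul, coe_suzukiM, coe_suzukiM, coe_suzukiM, torusMat_mul, Units.val_mul,
    mul_pow]

theorem suzukiM_one (n : ℕ) : (suzukiM n 1 : Sp4 F) = 1 := by
  have := suzukiM_mul (F := F) n 1 1
  rwa [one_mul, mul_eq_left] at this

theorem suzukiM_inv (n : ℕ) (l : Fˣ) : (suzukiM n l : Sp4 F)⁻¹ = suzukiM n l⁻¹ := by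
  rw [inv_eq_iff_mul_eq_one, suzukiM_mul, mul_inv_cancel, suzukiM_one]

theorem suzukiM_mul_suzukiS (n : ℕ) [Finite F] (hF : Nat.card F = 2 ^ (2 * n + 1)) (l : Fˣ)
    (a b : F) : suzukiM n l * suzukiS n a b =
      suzukiS n (a / l) (b / (((l : F) ^ 2 ^ n) ^ 2 * l)) * suzukiM n l := by
  apply Subtype.ext
  have e : (l : F) ^ 2 ^ (n + 1) = ((l : F) ^ 2 ^ n) ^ 2 := by rw [pow_succ, pow_mul]
  rw [Submonoid.coe_mul, Submonoid.coe_mul, coe_suzukiM, coe_suzukiS, coe_suzukiS,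
    torusMat_mul_lowerUni l.ne_zero (pow_ne_zero _ l.ne_zero), div_pow, div_pow, mul_pow,
    ← pow_mul _ 2 (2 ^ (n + 1)), mul_comm 2, pow_mul, twist_half hF, e]

theorem suzukiT_mul_self : suzukiT F * suzukiT F = 1 := by
  apply Subtype.ext
  simp [suzukiT, Matrix.fromBlocks_multiply]

theorem suzukiT_mul_suzukiM (n : ℕ) (l : Fˣ) :
    suzukiT F * suzukiM n l = suzukiM n l⁻¹ * suzukiT F := by
  apply Subtype.ext
  rw [Submonoid.coe_mul, Submonoid.coe_mul, coe_suzukiM, coe_suzukiM]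
  simp [suzukiT, torusMat, Matrix.fromBlocks_multiply]

/-- The denominator in `swap_lowerUni_swap` is the corner entry `f` of `S(a, b)`, nonzero by
`suzuki_form_ne_zero`. It remains to check that the factors found there have the correct twisted
entries, using `θ(φ) = f²` for `φ = θ(f)`. -/
theorem suzukiT_suzukiS_suzukiT (n : ℕ) [Finite F] (hF : Nat.card F = 2 ^ (2 * n + 1)) {a b : F}
    (h : ¬ (a = 0 ∧ b = 0)) : ∃ a₁ b₁ a₂ b₂ l, suzukiT F * suzukiS n a b * suzukiT F =
      suzukiS n a₁ b₁ * suzukiT F * (suzukiM n l * suzukiS n a₂ b₂) := by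
  have hf := suzuki_form_ne_zero hF h
  have h2 := twist_twist hF a
  have h3 := twist_twist hF b
  set A := a ^ 2 ^ (n + 1)
  set B := b ^ 2 ^ (n + 1)
  set f := a ^ 2 * A + a * b + B with ef
  set φ := f ^ 2 ^ (n + 1) with eφ
  have hφ : φ ≠ 0 := pow_ne_zero _ hf
  have hφ2 : φ ^ 2 ^ (n + 1) = f ^ 2 := twist_twist hF f
  have eφ' : φ = A ^ 2 * a ^ 2 + A * B + b ^ 2 := by
    rw [eφ, ef, add_twist, add_twist, mul_pow, mul_pow, h2, h3, ← pow_mul a, mul_comm 2, pow_mul a]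
  have hl : φ / f ^ 2 ≠ 0 := div_ne_zero hφ (pow_ne_zero _ hf)
  have hu : (φ / f ^ 2) ^ 2 ^ n = f / φ := by
    have : (f / φ) ^ 2 ^ (n + 1) = φ / f ^ 2 := by rw [div_pow, hφ2]
    rw [← this, ← pow_mul, mul_comm, pow_mul, twist_half hF]
  have ha₂ : ((a * A + b) / f) ^ 2 ^ (n + 1) = (A * a ^ 2 + B) / φ := by
    rw [div_pow, add_twist, mul_pow, h2]
  refine ⟨b / f, a / f, (a * A + b) / f, a / f + (a * A + b) / f * ((A * a ^ 2 + B) / φ),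
    Units.mk0 _ hl, ?_⟩
  apply Subtype.ext
  rw [Submonoid.coe_mul, Submonoid.coe_mul, Submonoid.coe_mul, Submonoid.coe_mul,
    Submonoid.coe_mul, coe_suzukiS, coe_suzukiS, coe_suzukiS, coe_suzukiM, Units.val_mk0, hu,
    add_twist, mul_pow, ha₂, div_pow b, div_pow a, ← ha₂, twist_twist hF, ha₂]
  exact swap_lowerUni_swap a A b B f φ hf hφ ef eφ'

/-- The Bruhat decomposition of the Suzuki group. -/
theorem exists_suzuki_borel (n : ℕ) [Finite F] (hF : Nat.card F = 2 ^ (2 * n + 1)) :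
    ∃ P : Subgroup (Sp4 F), P ≤ suzukiGroup F n ∧
      Nat.card P ≤ Nat.card F * Nat.card F * (Nat.card F - 1) ∧
      ∀ h ∈ suzukiGroup F n, h ∈ P ∨ ∃ p ∈ P, ∃ p' ∈ P, h = p * suzukiT F * p' := by
  let P : Subgroup (Sp4 F) :=
    { carrier := {g | ∃ a b l, g = suzukiS n a b * suzukiM n l}
      one_mem' := ⟨0, 0, 1, by rw [suzukiS_zero, suzukiM_one, one_mul]⟩
      mul_mem' := by
        rintro _ _ ⟨a, b, l, rfl⟩ ⟨c, d, l', rfl⟩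
        refine ⟨a + c / l, b + d / (((l : F) ^ 2 ^ n) ^ 2 * l) + a ^ 2 ^ (n + 1) * (c / l),
          l * l', ?_⟩
        rw [mul_assoc, ← mul_assoc (suzukiM n l), suzukiM_mul_suzukiS n hF, mul_assoc,
          suzukiM_mul, ← mul_assoc, suzukiS_mul n hF]
      inv_mem' := by
        rintro _ ⟨a, b, l, rfl⟩
        exact ⟨a / ↑l⁻¹, (b + a ^ 2 ^ (n + 1) * a) / ((((l⁻¹ : Fˣ) : F) ^ 2 ^ n) ^ 2 * ↑l⁻¹), l⁻¹,
          by rw [mul_inv_rev, suzukiM_inv, suzukiS_inv n hF, suzukiM_mul_suzukiS n hF]⟩ }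
  have hS : ∀ a b, suzukiS n a b ∈ P := fun a b => ⟨a, b, 1, by rw [suzukiM_one, mul_one]⟩
  have hM : ∀ l, suzukiM n l ∈ P := fun l => ⟨0, 0, l, by rw [suzukiS_zero, one_mul]⟩
  have hTi : (suzukiT F)⁻¹ = suzukiT F := inv_eq_of_mul_eq_one_left suzukiT_mul_self
  refine ⟨P, ?_, ?_, ?_⟩
  · rintro _ ⟨a, b, l, rfl⟩
    exact mul_mem (Subgroup.subset_closure (.inl (.inl ⟨a, b, rfl⟩)))
      (Subgroup.subset_closure (.inl (.inr ⟨l, rfl⟩)))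
  -- An upper bound for the order suffices, so uniqueness of the form `S(a, b) M(l)` is not needed.
  · have : Nat.card Fˣ = Nat.card F - 1 := Nat.card_units F
    rw [← this, ← Nat.card_prod, ← Nat.card_prod]
    refine Nat.card_le_card_of_surjective
      (fun x : (F × F) × Fˣ => (⟨suzukiS n x.1.1 x.1.2 * suzukiM n x.2, _, _, _, rfl⟩ : P)) ?_
    rintro ⟨_, a, b, l, rfl⟩
    exact ⟨((a, b), l), rfl⟩
  -- The set `P ∪ P T P` contains 1 and is stable under left multiplication by the generators and
  -- their inverses, so it contains the whole group.
  · have key : ∀ x ∈ P, ∀ h, (h ∈ P ∨ ∃ p ∈ P, ∃ p' ∈ P, h = p * suzukiT F * p') →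
        (x * h ∈ P ∨ ∃ p ∈ P, ∃ p' ∈ P, x * h = p * suzukiT F * p') := by
      rintro x hx h (hh | ⟨p, hp, p', hp', rfl⟩)
      · exact .inl (mul_mem hx hh)
      · exact .inr ⟨x * p, mul_mem hx hp, p', hp', by simp only [mul_assoc]⟩
    have keyT : ∀ h, (h ∈ P ∨ ∃ p ∈ P, ∃ p' ∈ P, h = p * suzukiT F * p') →
        (suzukiT F * h ∈ P ∨ ∃ p ∈ P, ∃ p' ∈ P, suzukiT F * h = p * suzukiT F * p') := by
      rintro h (hh | ⟨_, ⟨a, b, l, rfl⟩, p', hp', rfl⟩)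
      · exact .inr ⟨1, one_mem _, h, hh, by rw [one_mul]⟩
      -- Moving the torus factor across `T` inverts it and isolates `T S(a, b) T`.
      · have e : suzukiT F * (suzukiS n a b * suzukiM n l * suzukiT F * p') =
            suzukiT F * suzukiS n a b * suzukiT F * (suzukiM n l⁻¹ * p') := by
          have := suzukiT_mul_suzukiM (F := F) n l⁻¹
          rw [inv_inv] at this
          simp only [mul_assoc]
          rw [← mul_assoc (suzukiT F) (suzukiM n l⁻¹), this, mul_assoc]
        rw [e]
        by_cases h : a = 0 ∧ b = 0
        · rw [h.1, h.2, suzukiS_zero, mul_one, suzukiT_mul_self, one_mul]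
          exact .inl (mul_mem (hM _) hp')
        · obtain ⟨a₁, b₁, a₂, b₂, l', e'⟩ := suzukiT_suzukiS_suzukiT n hF h
          rw [e']
          exact .inr ⟨_, hS a₁ b₁, _, mul_mem (mul_mem (hM l') (hS a₂ b₂)) (mul_mem (hM l⁻¹) hp'),
            by simp only [mul_assoc]⟩
    intro h hh
    induction hh using Subgroup.closure_induction_left with
    | one => exact .inl (one_mem _)
    | mul_left x hx y _ ih =>
      rcases hx with (⟨a, b, rfl⟩ | ⟨l, rfl⟩) | rfl
      · exact key _ (hS a b) y ih
      · exact key _ (hM l) y ih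
      · exact keyT y ih
    | inv_mul_cancel x hx y _ ih =>
      rcases hx with (⟨a, b, rfl⟩ | ⟨l, rfl⟩) | rfl
      · exact key _ (inv_mem (hS a b)) y ih
      · exact key _ (inv_mem (hM l)) y ih
      · rw [hTi]
        exact keyT y ih

end SuzukiBorel

end

noncomputable section

/-! ### Symplectic bases in characteristic two. -/

section SymplecticGeometry

open Matrix Sum

variable {F : Type*}

/-- A vector of the natural module of `Sp₄(F)`, given by its coordinates. -/
def vec4 (a b c d : F) : Fin 2 ⊕ Fin 2 → F := Sum.elim ![a, b] ![c, d]

theorem eq_vec4 (v : Fin 2 ⊕ Fin 2 → F) :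
    v = vec4 (v (inl 0)) (v (inl 1)) (v (inr 0)) (v (inr 1)) := by
  ext i
  rcases i with i | i <;> fin_cases i <;> rfl

theorem vec4_inj {a b c d a' b' c' d' : F} :
    vec4 a b c d = vec4 a' b' c' d' ↔ a = a' ∧ b = b' ∧ c = c' ∧ d = d' := by
  refine ⟨fun h => ⟨congrFun h (inl 0), congrFun h (inl 1), congrFun h (inr 0),
    congrFun h (inr 1)⟩, ?_⟩
  rintro ⟨rfl, rfl, rfl, rfl⟩
  rfl

variable [Field F]

theorem vec4_add (a b c d a' b' c' d' : F) :
    vec4 a b c d + vec4 a' b' c' d' = vec4 (a + a') (b + b') (c + c') (d + d') := by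
  ext i
  rcases i with i | i <;> fin_cases i <;> rfl

theorem smul_vec4 (r a b c d : F) : r • vec4 a b c d = vec4 (r * a) (r * b) (r * c) (r * d) := by
  ext i
  rcases i with i | i <;> fin_cases i <;> rfl

theorem vec4_zero : vec4 0 0 0 0 = (0 : Fin 2 ⊕ Fin 2 → F) := by
  ext i
  rcases i with i | i <;> fin_cases i <;> rfl

/-- The vectors of the standard symplectic basis. -/
def stdBasis4 (F : Type*) [Field F] : Fin 2 ⊕ Fin 2 → Fin 2 ⊕ Fin 2 → F :=
  Sum.elim ![vec4 1 0 0 0, vec4 0 1 0 0] ![vec4 0 0 1 0, vec4 0 0 0 1]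

/-- The symplectic form, in characteristic two. -/
def sympForm (v w : Fin 2 ⊕ Fin 2 → F) : F :=
  v (inl 0) * w (inr 0) + v (inl 1) * w (inr 1) + v (inr 0) * w (inl 0) + v (inr 1) * w (inl 1)

theorem sympForm_vec4 (a b c d a' b' c' d' : F) :
    sympForm (vec4 a b c d) (vec4 a' b' c' d') = a * c' + b * d' + c * a' + d * b' := rfl

theorem mulVec_stdBasis4 (M : Matrix (Fin 2 ⊕ Fin 2) (Fin 2 ⊕ Fin 2) F) (j : Fin 2 ⊕ Fin 2) :
    M *ᵥ stdBasis4 F j = fun i => M i j := by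
  ext i
  rcases j with j | j <;> fin_cases j <;> simp [mulVec, dotProduct, stdBasis4, vec4]

theorem mem_symplecticGroup_iff_sympForm [CharP F 2]
    (A : Matrix (Fin 2 ⊕ Fin 2) (Fin 2 ⊕ Fin 2) F) :
    A ∈ symplecticGroup (Fin 2) F ↔
      ∀ i j, sympForm (fun k => A k i) (fun k => A k j) = J (Fin 2) F i j := by
  rw [SymplecticGroup.mem_iff', ← Matrix.ext_iff]
  refine forall₂_congr fun i j => ?_
  have : (Aᵀ * J (Fin 2) F * A) i j = sympForm (fun k => A k i) (fun k => A k j) := by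
    simp [mul_apply, J, sympForm, Fin.sum_univ_two, fromBlocks, CharTwo.neg_eq, one_apply]
    ring
  rw [this]

/-- Every symplectic basis is the image of the standard one under the symplectic group. -/
theorem exists_sp4_of_basis [CharP F 2] (a b c d : Fin 2 ⊕ Fin 2 → F) (hab : sympForm a b = 0)
    (hac : sympForm a c = 1) (had : sympForm a d = 0) (hbc : sympForm b c = 0)
    (hbd : sympForm b d = 1) (hcd : sympForm c d = 0) :
    ∃ g : Sp4 F, ∀ j, g.1 *ᵥ stdBasis4 F j = (Sum.elim ![a, b] ![c, d]) j := by
  have symm : ∀ v w : Fin 2 ⊕ Fin 2 → F, sympForm v w = sympForm w v := fun v w => by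
    simp only [sympForm]
    ring
  have alt : ∀ v : Fin 2 ⊕ Fin 2 → F, sympForm v v = 0 := fun v => by
    have h2 : (2 : F) = 0 := CharTwo.two_eq_zero
    simp only [sympForm]
    linear_combination (v (inl 0) * v (inr 0) + v (inl 1) * v (inr 1)) * h2
  refine ⟨⟨Matrix.of fun i j => (Sum.elim ![a, b] ![c, d] : _ → _ → F) j i, ?_⟩, fun j => ?_⟩
  · rw [mem_symplecticGroup_iff_sympForm]
    rintro (i | i) (j | j) <;> fin_cases i <;> fin_cases j <;>
      simp [J, alt, hab, hac, had, hbc, hbd, hcd, symm b a, symm c a, symm d a, symm c b,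
        symm d b, symm d c, CharTwo.neg_eq]
  · rw [mulVec_stdBasis4]
    rfl

/-! ### The flag stabilizer and its double cosets. -/

/-- The stabilizer of the first basis vector and of the plane of the first two basis vectors. -/
def flagSubgroup (F : Type*) [Field F] [Finite F] : Subgroup (Sp4 F) where
  carrier := {g | g.1 *ᵥ stdBasis4 F (inl 0) = stdBasis4 F (inl 0) ∧
    ∃ r s : F, g.1 *ᵥ stdBasis4 F (inl 1) = r • stdBasis4 F (inl 0) + s • stdBasis4 F (inl 1)}
  one_mem' := ⟨by simp, 0, 1, by simp⟩
  mul_mem' := by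
    rintro g h ⟨hg, r, s, hg'⟩ ⟨hh, r', s', hh'⟩
    refine ⟨?_, r' + s' * r, s' * s, ?_⟩
    · rw [Submonoid.coe_mul, ← mulVec_mulVec, hh, hg]
    · rw [Submonoid.coe_mul, ← mulVec_mulVec, hh', mulVec_add, mulVec_smul, mulVec_smul, hg, hg']
      module
  inv_mem' := by
    rintro g ⟨hg, r, s, hg'⟩
    have hi : ∀ v, (g⁻¹).1 *ᵥ (g.1 *ᵥ v) = v := fun v => by
      rw [mulVec_mulVec, ← Submonoid.coe_mul, inv_mul_cancel, Submonoid.coe_one, one_mulVec]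
    have h0 : (g⁻¹).1 *ᵥ stdBasis4 F (inl 0) = stdBasis4 F (inl 0) := by
      conv_lhs => rw [← hg]
      exact hi _
    have hs : s ≠ 0 := by
      rintro rfl
      have h1 := hi (stdBasis4 F (inl 1))
      rw [hg', zero_smul, add_zero, mulVec_smul, h0] at h1
      have := congrFun h1 (inl 1)
      simp [stdBasis4, vec4] at this
    refine ⟨h0, -(s⁻¹ * r), s⁻¹, ?_⟩
    have h1 := hi (stdBasis4 F (inl 1))
    rw [hg', mulVec_add, mulVec_smul, mulVec_smul, h0] at h1
    rw [← inv_smul_smul₀ hs ((g⁻¹).1 *ᵥ stdBasis4 F (inl 1)), eq_sub_of_add_eq' h1]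
    module

theorem mem_flagSubgroup [Finite F] {g : Sp4 F} : g ∈ flagSubgroup F ↔
    g.1 *ᵥ stdBasis4 F (inl 0) = stdBasis4 F (inl 0) ∧
    ∃ r s : F, g.1 *ᵥ stdBasis4 F (inl 1) = r • stdBasis4 F (inl 0) + s • stdBasis4 F (inl 1) :=
  Iff.rfl

/-- A coset of `flagSubgroup F` is a flag: the image of the first basis vector together with the
plane spanned by the images of the first two. -/
theorem inv_mul_mem_flagSubgroup [Finite F] {g h : Sp4 F} : g⁻¹ * h ∈ flagSubgroup F ↔
    h.1 *ᵥ stdBasis4 F (inl 0) = g.1 *ᵥ stdBasis4 F (inl 0) ∧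
    ∃ r s : F, h.1 *ᵥ stdBasis4 F (inl 1) =
      r • g.1 *ᵥ stdBasis4 F (inl 0) + s • g.1 *ᵥ stdBasis4 F (inl 1) := by
  have hi : ∀ v w, (g⁻¹ * h).1 *ᵥ v = w ↔ h.1 *ᵥ v = g.1 *ᵥ w := by
    intro v w
    constructor
    · rintro rfl
      rw [mulVec_mulVec, ← Submonoid.coe_mul, mul_inv_cancel_left]
    · intro e
      rw [Submonoid.coe_mul, ← mulVec_mulVec, e, mulVec_mulVec, ← Submonoid.coe_mul,
        inv_mul_cancel, Submonoid.coe_one, one_mulVec]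
  simp only [mem_flagSubgroup, hi, mulVec_add, mulVec_smul]

/-- The index set of the double cosets of `flagSubgroup F`: the coefficient and the position of the
image of the first basis vector, and the position of the image of the second one. -/
def flagIndex : (Fˣ × Fin 4) ⊕ Fin 4 → F × (Fin 2 ⊕ Fin 2) × (Fin 2 ⊕ Fin 2)
  -- One index for each of the eight Weyl group elements, except that a scalar survives when the
  -- first vector goes to itself or its dual vector. The subgroup fixes the first vector but can
  -- rescale the second and its dual, so in the other four cases the scalar is absorbed.
  | inl (c, i) => (c, ![inr 0, inr 0, inl 0, inl 0] i, ![inr 1, inl 1, inl 1, inr 1] i)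
  | inr i => (1, ![inl 1, inl 1, inr 1, inr 1] i, ![inl 0, inr 0, inl 0, inr 0] i)

/-- Monomial representatives of the double cosets of `flagSubgroup F`. -/
theorem exists_flag_representative [CharP F 2] (i : (Fˣ × Fin 4) ⊕ Fin 4) :
    ∃ k : Sp4 F, k.1 *ᵥ stdBasis4 F (inl 0) = (flagIndex i).1 • stdBasis4 F (flagIndex i).2.1 ∧
      k.1 *ᵥ stdBasis4 F (inl 1) = stdBasis4 F (flagIndex i).2.2 := by
  suffices h : ∃ c d : Fin 2 ⊕ Fin 2 → F, sympForm ((flagIndex i).1 • stdBasis4 F (flagIndex i).2.1)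
        (stdBasis4 F (flagIndex i).2.2) = 0 ∧
      sympForm ((flagIndex i).1 • stdBasis4 F (flagIndex i).2.1) c = 1 ∧
      sympForm ((flagIndex i).1 • stdBasis4 F (flagIndex i).2.1) d = 0 ∧
      sympForm (stdBasis4 F (flagIndex i).2.2) c = 0 ∧
      sympForm (stdBasis4 F (flagIndex i).2.2) d = 1 ∧ sympForm c d = 0 by
    obtain ⟨c, d, h1, h2, h3, h4, h5, h6⟩ := h
    obtain ⟨g, hg⟩ := exists_sp4_of_basis _ _ c d h1 h2 h3 h4 h5 h6
    exact ⟨g, hg (inl 0), hg (inl 1)⟩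
  rcases i with ⟨c, i⟩ | i
  · fin_cases i
    · refine ⟨vec4 (c⁻¹ : Fˣ) 0 0 0, vec4 0 1 0 0, ?_⟩
      simp [flagIndex, stdBasis4, smul_vec4, sympForm_vec4]
    · refine ⟨vec4 (c⁻¹ : Fˣ) 0 0 0, vec4 0 0 0 1, ?_⟩
      simp [flagIndex, stdBasis4, smul_vec4, sympForm_vec4]
    · refine ⟨vec4 0 0 (c⁻¹ : Fˣ) 0, vec4 0 0 0 1, ?_⟩
      simp [flagIndex, stdBasis4, smul_vec4, sympForm_vec4]
    · refine ⟨vec4 0 0 (c⁻¹ : Fˣ) 0, vec4 0 1 0 0, ?_⟩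
      simp [flagIndex, stdBasis4, smul_vec4, sympForm_vec4]
  · fin_cases i
    · refine ⟨vec4 0 0 0 1, vec4 0 0 1 0, ?_⟩
      simp [flagIndex, stdBasis4, sympForm_vec4]
    · refine ⟨vec4 0 0 0 1, vec4 1 0 0 0, ?_⟩
      simp [flagIndex, stdBasis4, sympForm_vec4]
    · refine ⟨vec4 0 1 0 0, vec4 0 0 1 0, ?_⟩
      simp [flagIndex, stdBasis4, sympForm_vec4]
    · refine ⟨vec4 0 1 0 0, vec4 1 0 0 0, ?_⟩
      simp [flagIndex, stdBasis4, sympForm_vec4]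

/-- The isotropic flags are moved to one of the standard positions by `flagSubgroup F`. -/
theorem exists_flagSubgroup_normal_form [CharP F 2] [Finite F] (w₀ w₁ w₂ w₃ x₀ x₁ x₂ x₃ : F)
    (hw : vec4 w₀ w₁ w₂ w₃ ≠ 0)
    (hwx : w₀ * x₂ + w₁ * x₃ + w₂ * x₀ + w₃ * x₁ = 0) :
    ∃ i : (Fˣ × Fin 4) ⊕ Fin 4, ∃ h ∈ flagSubgroup F,
      h.1 *ᵥ ((flagIndex i).1 • stdBasis4 F (flagIndex i).2.1) = vec4 w₀ w₁ w₂ w₃ ∧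
      ∃ r s : F, vec4 x₀ x₁ x₂ x₃ =
        r • vec4 w₀ w₁ w₂ w₃ + s • h.1 *ᵥ stdBasis4 F (flagIndex i).2.2 := by
  have h2 : (2 : F) = 0 := CharTwo.two_eq_zero
  -- The four vectors are the images of the standard basis under the sought `h`; the shapes of the
  -- first two place it in `flagSubgroup F`. Each case below then only supplies coordinates.
  have main : ∀ (i : (Fˣ × Fin 4) ⊕ Fin 4) (r s r' s' c₀ c₁ c₂ c₃ d₀ d₁ d₂ d₃ : F),
      sympForm (vec4 1 0 0 0) (vec4 r s 0 0) = 0 →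
      sympForm (vec4 1 0 0 0) (vec4 c₀ c₁ c₂ c₃) = 1 →
      sympForm (vec4 1 0 0 0) (vec4 d₀ d₁ d₂ d₃) = 0 →
      sympForm (vec4 r s 0 0) (vec4 c₀ c₁ c₂ c₃) = 0 →
      sympForm (vec4 r s 0 0) (vec4 d₀ d₁ d₂ d₃) = 1 →
      sympForm (vec4 c₀ c₁ c₂ c₃) (vec4 d₀ d₁ d₂ d₃) = 0 →
      (flagIndex i).1 • (Sum.elim ![vec4 1 0 0 0, vec4 r s 0 0]
        ![vec4 c₀ c₁ c₂ c₃, vec4 d₀ d₁ d₂ d₃]) (flagIndex i).2.1 = vec4 w₀ w₁ w₂ w₃ →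
      vec4 x₀ x₁ x₂ x₃ = r' • vec4 w₀ w₁ w₂ w₃ + s' • (Sum.elim ![vec4 1 0 0 0, vec4 r s 0 0]
        ![vec4 c₀ c₁ c₂ c₃, vec4 d₀ d₁ d₂ d₃]) (flagIndex i).2.2 →
      ∃ i : (Fˣ × Fin 4) ⊕ Fin 4, ∃ h ∈ flagSubgroup F,
      h.1 *ᵥ ((flagIndex i).1 • stdBasis4 F (flagIndex i).2.1) = vec4 w₀ w₁ w₂ w₃ ∧
      ∃ r s : F, vec4 x₀ x₁ x₂ x₃ =
        r • vec4 w₀ w₁ w₂ w₃ + s • h.1 *ᵥ stdBasis4 F (flagIndex i).2.2 := by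
    intro i r s r' s' c₀ c₁ c₂ c₃ d₀ d₁ d₂ d₃ h1 h2 h3 h4 h5 h6 h7 h8
    obtain ⟨g, hg⟩ := exists_sp4_of_basis _ _ _ _ h1 h2 h3 h4 h5 h6
    refine ⟨i, g, ⟨hg (inl 0), r, s, ?_⟩, ?_, r', s', ?_⟩
    · rw [hg (inl 1)]
      simp [stdBasis4, smul_vec4, vec4_add]
    · rw [mulVec_smul, hg, h7]
    · rw [hg, h8]
  -- The cases follow the position of `w` relative to `⟨e₁⟩ ⊂ ⟨e₁, e₂⟩ ⊂ e₁^⊥`, where `w₂ = 0` means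
  -- `w ∈ e₁^⊥`, and then the position of the plane of `w` and `x`.
  by_cases hw2 : w₂ = 0
  · subst hw2
    by_cases hw3 : w₃ = 0
    · subst hw3
      by_cases hw1 : w₁ = 0
      · subst hw1
        have hw0 : w₀ ≠ 0 := by
          rintro rfl
          exact hw vec4_zero
        have hx2 : x₂ = 0 := by simpa [hw0] using hwx
        subst hx2
        by_cases hx3 : x₃ = 0
        · subst hx3
          refine main (inl (Units.mk0 w₀ hw0, 2)) 0 1 (x₀ / w₀) x₁ 0 0 1 0 0 0 0 1
            ?_ ?_ ?_ ?_ ?_ ?_ ?_ ?_ <;>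
          simp [flagIndex, smul_vec4, vec4_add, sympForm_vec4, hw0]
        · refine main (inl (Units.mk0 w₀ hw0, 3)) 0 1 0 x₃ 0 (x₀ / x₃) 1 0 (x₀ / x₃) (x₁ / x₃) 0 1
            ?_ ?_ ?_ ?_ ?_ ?_ ?_ ?_ <;>
          simp [flagIndex, smul_vec4, vec4_inj, sympForm_vec4] <;> field_simp <;> grind
      · by_cases hx2 : x₂ = 0
        · subst hx2
          have hx3 : x₃ = 0 := by simpa [hw1] using hwx
          subst hx3
          refine main (inr 0) w₀ w₁ (x₁ / w₁) (x₀ + x₁ / w₁ * w₀) 0 0 1 (w₀ / w₁) 0 0 0 w₁⁻¹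
            ?_ ?_ ?_ ?_ ?_ ?_ ?_ ?_ <;>
          simp [flagIndex, smul_vec4, vec4_add, vec4_inj, sympForm_vec4] <;> field_simp <;> grind
        · refine main (inr 1) w₀ w₁ 0 x₂ (x₀ / x₂) (x₁ / x₂) 1 (x₃ / x₂) (x₁ / (w₁ * x₂)) 0 0 w₁⁻¹
            ?_ ?_ ?_ ?_ ?_ ?_ ?_ ?_ <;>
          simp [flagIndex, smul_vec4, vec4_inj, sympForm_vec4] <;> field_simp <;> grind
    · by_cases hx2 : x₂ = 0
      · subst hx2
        refine main (inr 2) 0 w₃⁻¹ (x₃ / w₃) (x₀ + x₃ / w₃ * w₀) 0 (w₀ / w₃) 1 0 w₀ w₁ 0 w₃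
            ?_ ?_ ?_ ?_ ?_ ?_ ?_ ?_ <;>
          simp [flagIndex, smul_vec4, vec4_add, vec4_inj, sympForm_vec4] <;> field_simp <;> grind
      · refine main (inr 3) (x₃ / (w₃ * x₂)) w₃⁻¹ 0 x₂ (x₀ / x₂) (x₁ / x₂) 1 (x₃ / x₂) w₀ w₁ 0 w₃
            ?_ ?_ ?_ ?_ ?_ ?_ ?_ ?_ <;>
          simp [flagIndex, smul_vec4, vec4_inj, sympForm_vec4] <;> field_simp <;> grind
  -- Adding `(x₂ / w₂) w` to `x` kills the coordinate `x₂`; the tested quantity is the last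
  -- coordinate of the result.
  · by_cases hy : x₃ + x₂ / w₂ * w₃ = 0
    · refine main (inl (Units.mk0 w₂ hw2, 1)) (w₃ / w₂) 1 (x₂ / w₂) (x₁ + x₂ / w₂ * w₁)
            (w₀ / w₂) (w₁ / w₂) 1 (w₃ / w₂) (w₁ / w₂) 0 0 1
            ?_ ?_ ?_ ?_ ?_ ?_ ?_ ?_ <;>
          simp [flagIndex, smul_vec4, vec4_add, vec4_inj, sympForm_vec4] <;> field_simp at hy ⊢ <;>
          grind
    · obtain ⟨y, e⟩ : ∃ y, y = x₃ + x₂ / w₂ * w₃ := ⟨_, rfl⟩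
      rw [← e] at hy
      refine main (inl (Units.mk0 w₂ hw2, 0)) (w₃ / w₂) 1 (x₂ / w₂) y
            (w₀ / w₂) (w₁ / w₂) 1 (w₃ / w₂) ((x₀ + x₂ / w₂ * w₀) / y) ((x₁ + x₂ / w₂ * w₁) / y) 0 1
            ?_ ?_ ?_ ?_ ?_ ?_ ?_ ?_ <;>
          simp [flagIndex, smul_vec4, vec4_add, vec4_inj, sympForm_vec4] <;>
          field_simp at e ⊢ <;> grind

end SymplecticGeometry

end

noncomputable section

/-! ### Counting flags and their double cosets. -/

section Main

open Matrix Sum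

/-- The number of orbits on pairs of cosets of `L` is at most the number of double cosets. -/
theorem card_orbits_quotient_prod_le {G I : Type*} [Group G] [Finite I] (L : Subgroup G) (k : I → G)
    (hk : ∀ g, ∃ i, ∃ h ∈ L, (h * k i)⁻¹ * g ∈ L) :
    Nat.card (MulAction.orbitRel.Quotient G ((G ⧸ L) × (G ⧸ L))) ≤ Nat.card I := by
  refine Nat.card_le_card_of_surjective
    (fun i => (Quotient.mk'' (((1 : G) : G ⧸ L), (k i : G ⧸ L)) : MulAction.orbitRel.Quotient G ((G ⧸ L) × (G ⧸ L)))) fun o => ?_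
  induction o using Quotient.inductionOn' with | h p => ?_
  obtain ⟨⟨a⟩, ⟨b⟩⟩ := p
  obtain ⟨i, h, hh, e⟩ := hk (a⁻¹ * b)
  refine ⟨i, (Quotient.eq''.mpr ?_).symm⟩
  rw [MulAction.orbitRel_apply]
  refine ⟨a * h, Prod.ext ?_ ?_⟩
  · change (((a * h) * 1 : G) : G ⧸ L) = (a : G ⧸ L)
    rw [mul_one, QuotientGroup.mk_mul_of_mem _ hh]
  · change (((a * h) * k i : G) : G ⧸ L) = (b : G ⧸ L)
    rw [QuotientGroup.eq]
    simpa [mul_assoc] using e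

variable {F : Type*} [Field F]

theorem card_orbits_flags_le [CharP F 2] [Finite F] :
    Nat.card (MulAction.orbitRel.Quotient (Sp4 F)
      ((Sp4 F ⧸ flagSubgroup F) × (Sp4 F ⧸ flagSubgroup F))) ≤ 4 * Nat.card F := by
  choose k hk hk' using exists_flag_representative (F := F)
  refine (card_orbits_quotient_prod_le (flagSubgroup F) k fun g => ?_).trans ?_
  · have hinv : ∀ v, (g⁻¹).1 *ᵥ (g.1 *ᵥ v) = v := fun v => by
      rw [mulVec_mulVec, ← Submonoid.coe_mul, inv_mul_cancel, Submonoid.coe_one, one_mulVec]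
    have e0 := eq_vec4 (g.1 *ᵥ stdBasis4 F (inl 0))
    have e1 := eq_vec4 (g.1 *ᵥ stdBasis4 F (inl 1))
    obtain ⟨i, h, hh, e, r, s, e'⟩ := exists_flagSubgroup_normal_form _ _ _ _
      ((g.1 *ᵥ stdBasis4 F (inl 1)) (inl 0)) ((g.1 *ᵥ stdBasis4 F (inl 1)) (inl 1))
      ((g.1 *ᵥ stdBasis4 F (inl 1)) (inr 0)) ((g.1 *ᵥ stdBasis4 F (inl 1)) (inr 1))
      (by
        rw [← e0]
        intro h0
        have := hinv (stdBasis4 F (inl 0))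
        rw [h0, mulVec_zero] at this
        have := congrFun this (inl 0)
        simp [stdBasis4, vec4] at this)
      (by
        have := (mem_symplecticGroup_iff_sympForm g.1).mp g.2 (inl 0) (inl 1)
        rw [← mulVec_stdBasis4, ← mulVec_stdBasis4] at this
        simpa [J, sympForm] using this)
    rw [← e0] at e e'
    rw [← e1] at e'
    refine ⟨i, h, hh, inv_mul_mem_flagSubgroup.mpr ⟨?_, r, s, ?_⟩⟩
    · rw [Submonoid.coe_mul, ← mulVec_mulVec, hk, e]
    · rw [Submonoid.coe_mul, ← mulVec_mulVec, ← mulVec_mulVec, hk, hk', e, e']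
  -- The index set has `4(q-1) + 4 = 4q` elements.
  · rw [Nat.card_sum, Nat.card_prod, Nat.card_units, Nat.card_fin]
    have : 0 < Nat.card F := Nat.card_pos
    omega

/-- A vector outside the hyperbolic plane spanned by the second and fourth basis vectors is the
image of the first basis vector under the symplectic group. -/
theorem exists_sp4_mulVec_eq [CharP F 2] (a b c d : F) (h : (a, c) ≠ 0) :
    ∃ g : Sp4 F, g.1 *ᵥ stdBasis4 F (inl 0) = vec4 a b c d := by
  have h2 : (2 : F) = 0 := CharTwo.two_eq_zero
  by_cases ha : a = 0
  · have hc : c ≠ 0 := by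
      rintro rfl
      exact h (by rw [ha]; rfl)
    obtain ⟨g, hg⟩ := exists_sp4_of_basis (vec4 a b c d) (vec4 (d / c) 1 0 0) (vec4 c⁻¹ 0 0 0)
      (vec4 (b / c) 0 0 1) (by simp [sympForm_vec4]; field_simp; grind)
      (by simp [sympForm_vec4]; field_simp) (by simp [sympForm_vec4]; field_simp; grind)
      (by simp [sympForm_vec4]) (by simp [sympForm_vec4]) (by simp [sympForm_vec4])
    exact ⟨g, hg (inl 0)⟩
  · obtain ⟨g, hg⟩ := exists_sp4_of_basis (vec4 a b c d) (vec4 0 1 (d / a) 0) (vec4 0 0 a⁻¹ 0)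
      (vec4 0 0 (b / a) 1) (by simp [sympForm_vec4]; field_simp; grind)
      (by simp [sympForm_vec4]; field_simp) (by simp [sympForm_vec4]; field_simp; grind)
      (by simp [sympForm_vec4]) (by simp [sympForm_vec4]) (by simp [sympForm_vec4])
    exact ⟨g, hg (inl 0)⟩

/-- Only part of the flags is listed: `(q²-1)q²` vectors with `(a, c) ≠ 0`, and through each of them
`q` isotropic planes. The exact number is not needed. -/
theorem le_card_flags [CharP F 2] [Finite F] :
    (Nat.card F ^ 2 - 1) * Nat.card F ^ 3 ≤ Nat.card (Sp4 F ⧸ flagSubgroup F) := by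
  choose g hg using fun (p : {p : F × F // p ≠ 0}) (x : F × F) =>
    exists_sp4_mulVec_eq p.1.1 x.1 p.1.2 x.2 p.2
  -- These fix the first basis vector and move the standard plane to `⟨e₁, e₂ + t e₂'⟩`, with `e₂'`
  -- dual to `e₂`; distinct `t` give distinct planes.
  choose k hk using fun t : F => exists_sp4_of_basis (vec4 1 0 0 0) (vec4 0 1 0 t) (vec4 0 0 1 0)
    (vec4 0 0 0 1) (by simp [sympForm_vec4]) (by simp [sympForm_vec4]) (by simp [sympForm_vec4])
    (by simp [sympForm_vec4]) (by simp [sympForm_vec4]) (by simp [sympForm_vec4])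
  have hcard : Nat.card ({p : F × F // p ≠ 0} × (F × F) × F) =
      (Nat.card F ^ 2 - 1) * Nat.card F ^ 3 := by
    classical
    have := Fintype.ofFinite F
    simp only [Nat.card_eq_fintype_card, Fintype.card_prod, ne_eq, Fintype.card_subtype_compl,
      Fintype.card_unique]
    ring_nf
  rw [← hcard]
  refine Nat.card_le_card_of_injective
    (fun y => ((g y.1 y.2.1 * k y.2.2 : Sp4 F) : Sp4 F ⧸ flagSubgroup F)) ?_
  rintro ⟨p, x, t⟩ ⟨p', x', t'⟩ e
  rw [QuotientGroup.eq, inv_mul_mem_flagSubgroup] at e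
  obtain ⟨e0, r, s, e1⟩ := e
  have hk0 : ∀ t, (k t).1 *ᵥ stdBasis4 F (inl 0) = stdBasis4 F (inl 0) := fun t => hk t (inl 0)
  have hk1 : ∀ t, (k t).1 *ᵥ stdBasis4 F (inl 1) = vec4 0 1 0 t := fun t => hk t (inl 1)
  simp only [Submonoid.coe_mul, ← mulVec_mulVec, hk0, hk1] at e0 e1
  have e0' := e0
  rw [hg, hg, vec4_inj] at e0'
  have hp : p' = p := Subtype.ext (Prod.ext e0'.1 e0'.2.2.1)
  have hx : x' = x := Prod.ext e0'.2.1 e0'.2.2.2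
  subst hp hx
  rw [← mulVec_smul, ← mulVec_smul, ← mulVec_add] at e1
  have e2 : vec4 0 1 0 t' = r • stdBasis4 F (inl 0) + s • vec4 0 1 0 t := by
    have := congrArg (fun v => ((g p' x')⁻¹).1 *ᵥ v) e1
    simpa only [mulVec_mulVec, ← Submonoid.coe_mul, inv_mul_cancel, Submonoid.coe_one, one_mulVec,
      ← mul_assoc] using this
  simp only [stdBasis4, elim_inl, cons_val_zero, smul_vec4, vec4_add, vec4_inj] at e2
  have ht : t = t' := by
    obtain ⟨-, h1, -, h3⟩ := e2
    simp only [mul_zero, mul_one, zero_add] at h1 h3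
    rw [h3, ← h1, one_mul]
  rw [ht]

end Main

end

/-- For `q = 2 ^ (2 * n + 1)` with `n ≥ 1`, the Suzuki subgroup `Sz(q)` of `Sp₄(q)` (up to
conjugacy in `Sp₄(q)`) is not a strong Gelfand subgroup. -/
theorem mainTheorem7 (n : ℕ) (hn : 1 ≤ n) (F : Type*) [Field F] [Finite F] [CharP F 2]
    (hF : Nat.card F = 2 ^ (2 * n + 1)) (H : Subgroup (Sp4 F))
    (hH : ∃ g : Sp4 F, H = (suzukiGroup F n).map (MulAut.conj g).toMonoidHom) :
    ¬ IsStrongGelfandSubgroup H := by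
  intro hGH
  obtain ⟨g, rfl⟩ := hH
  obtain ⟨P, hP, hPcard, hB⟩ := exists_suzuki_borel n hF
  set c : Sp4 F →* Sp4 F := (MulAut.conj g).toMonoidHom
  have hc : Function.Injective c := (MulAut.conj g).injective
  set H := (suzukiGroup F n).map c
  let Q : Subgroup H := (P.map c).subgroupOf H
  have hQ : Nat.card Q = Nat.card P := by
    rw [Nat.card_congr (Subgroup.subgroupOfEquivOfLe (Subgroup.map_mono hP)).toEquiv,
      Subgroup.card_map_of_injective hc]
  let t : H := ⟨c (suzukiT F), Subgroup.mem_map_of_mem c (Subgroup.subset_closure (.inr rfl))⟩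
  -- The Bruhat decomposition leaves two double cosets, represented by `1` and `t`.
  have hY : Nat.card (MulAction.orbitRel.Quotient H ((H ⧸ Q) × (H ⧸ Q))) ≤ 2 := by
    refine (card_orbits_quotient_prod_le Q (fun b : Bool => if b then t else 1)
      fun x => ?_).trans (by simp)
    obtain ⟨_, y, hy, rfl⟩ := x
    rcases hB y hy with h | ⟨p, hp, p', hp', rfl⟩
    · refine ⟨false, 1, one_mem _, ?_⟩
      simpa [Q, Subgroup.mem_subgroupOf] using Subgroup.mem_map_of_mem c h
    · refine ⟨true, ⟨c p, Subgroup.mem_map_of_mem c (hP hp)⟩, Subgroup.mem_map_of_mem c hp, ?_⟩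
      have : c p' ∈ P.map c := Subgroup.mem_map_of_mem c hp'
      simpa [Q, Subgroup.mem_subgroupOf, t, mul_assoc] using this
  have hX := card_orbits_flags_le (F := F)
  have hX' := le_card_flags (F := F)
  have hmain := hGH.card_mul_card_le (X := Sp4 F ⧸ flagSubgroup F) (Y := H ⧸ Q)
  have hLag : Nat.card H = Nat.card (H ⧸ Q) * Nat.card Q :=
    Subgroup.card_eq_card_quotient_mul_card_subgroup Q
  -- Cancelling `|Y| = |H ⧸ Q|` leaves `|X|` at most `|P|` times the product of the ranks.
  rw [hLag, hQ, mul_comm, mul_assoc] at hmain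
  have hmain := Nat.le_of_mul_le_mul_left hmain (Nat.card_pos (α := H ⧸ Q))
  -- Here `n ≥ 1` enters: the final inequality would be consistent for `q = 2`.
  have hq : 8 ≤ Nat.card F := by
    rw [hF]
    calc 8 = 2 ^ 3 := by norm_num
      _ ≤ 2 ^ (2 * n + 1) := Nat.pow_le_pow_right (by norm_num) (by omega)
  have hbound := (hX'.trans hmain).trans (Nat.mul_le_mul hPcard (Nat.mul_le_mul hY hX))
  -- Writing `q = m + 8` removes the truncated subtractions; the bound becomes `m + 9 ≤ 8` times the
  -- positive factor `(m + 7)(m + 8)³`.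
  obtain ⟨m, hm⟩ : ∃ m, Nat.card F = m + 8 := ⟨_, (Nat.sub_add_cancel hq).symm⟩
  have hsq : (m + 8) ^ 2 = (m + 7) * (m + 9) + 1 := by ring
  rw [hm, show (m + 8) ^ 2 - 1 = (m + 7) * (m + 9) by rw [hsq, Nat.add_sub_cancel],
    show m + 8 - 1 = m + 7 by omega] at hbound
  have hpos : 0 < (m + 7) * (m + 8) ^ 3 := by positivity
  nlinarith [Nat.zero_le (m * ((m + 7) * (m + 8) ^ 3))]
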